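/- A mixed hypergraph is a triple $\mathcal H=(X,\mathcal C,\mathcal D)$ with $X$ a finite set and $\mathcal C,\mathcal D$ families of subsets of $X$. A strict $k$-coloring of $\mathcal H$ is a surjective map $c$ from $X$ onto a set of $k$ colors such that every $C\in\mathcal C$ contains two different vertices of the same color and every $D\in\mathcal D$ contains two vertices of different colors. The feasible set $\mathcal F(\mathcal H)$ is the set of all $k$ for which $\mathcal H$ has a strict $k$-coloring, and $r_k$ denotes the number of partitions of $X$ that are the partition into color classes of some strict $k$-coloring of $\mathcal H$. For a set $S$ of positive integers, $\mathcal H$ is a one-realization of $S$ if $\mathcal F(\mathcal H)=S$ and $r_k\in\{0,1\}$ for every $k$. **Theorem.** Let $s\ge 2$, let $n_1>n_2>\cdots>n_s\ge 2$ be integers, and let $S=\{n_1,n_2,\ldots,n_s\}$. Then one-realizations of $S$ exist, and the minimum number $\delta(S)$ of vertices of a one-realization of $S$ is $$\delta(S)=\begin{cases}2n_1-n_s, & \text{if } n_1>n_2+1,\\ 2n_1-n_s-1, & \text{if } n_1=n_2+1.\end{cases}$$ -/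

import Mathlib

universe u

/-- A mixed hypergraph with vertex set `X` (finiteness of `X` is required where it is used):
a family of `C`-edges and a family of `D`-edges, both consisting of subsets of `X`. -/
structure MixedHypergraph (X : Type*) where
  /-- the family of `C`-edges -/
  cEdges : Set (Set X)
  /-- the family of `D`-edges -/
  dEdges : Set (Set X)

namespace MixedHypergraph

/-- A proper `k`-coloring: every `C`-edge has two (different) vertices with a common color and
every `D`-edge has two vertices with distinct colors. -/
def IsProperColoring {X : Type*} (H : MixedHypergraph X) {k : ℕ} (c : X → Fin k) : Prop :=
  (∀ e ∈ H.cEdges, ∃ x ∈ e, ∃ y ∈ e, x ≠ y ∧ c x = c y) ∧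
  (∀ e ∈ H.dEdges, ∃ x ∈ e, ∃ y ∈ e, c x ≠ c y)

/-- A strict `k`-coloring: a proper `k`-coloring that uses all of the `k` colors. -/
def IsStrictColoring {X : Type*} (H : MixedHypergraph X) {k : ℕ} (c : X → Fin k) : Prop :=
  H.IsProperColoring c ∧ Function.Surjective c

/-- The feasible set: all `k` for which there is a strict `k`-coloring. -/
def feasibleSet {X : Type*} (H : MixedHypergraph X) : Set ℕ :=
  {k | ∃ c : X → Fin k, H.IsStrictColoring c}

/-- The feasible partitions into `k` classes: the partitions of the vertex set (given as
equivalence relations) into the color classes of a strict `k`-coloring. -/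
def feasiblePartitions {X : Type*} (H : MixedHypergraph X) (k : ℕ) : Set (Setoid X) :=
  {r | ∃ c : X → Fin k, H.IsStrictColoring c ∧ Setoid.ker c = r}

/-- The entry `r_k` of the chromatic spectrum: the number of feasible partitions into `k`
classes. It is `0` for `k` larger than the upper chromatic number, and at most `1` for `k = 0`. -/
noncomputable def chromaticSpectrum {X : Type*} (H : MixedHypergraph X) (k : ℕ) : ℕ :=
  (H.feasiblePartitions k).ncard

/-- `H` is a realization of `S` if its feasible set is `S`. -/
def IsRealization {X : Type*} (H : MixedHypergraph X) (S : Set ℕ) : Prop :=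
  H.feasibleSet = S

/-- `H` is a one-realization of `S` if it is a realization of `S` and all the entries of its
chromatic spectrum are `0` or `1`. -/
def IsOneRealization {X : Type*} (H : MixedHypergraph X) (S : Set ℕ) : Prop :=
  H.IsRealization S ∧ ∀ k, H.chromaticSpectrum k = 0 ∨ H.chromaticSpectrum k = 1

/-- The set of all sizes (numbers of vertices) of one-realizations of `S` on finite vertex
sets. -/
def oneRealizationSizes (S : Set ℕ) : Set ℕ :=
  {m | ∃ (X : Type u) (_ : Finite X) (H : MixedHypergraph X),
    H.IsOneRealization S ∧ Nat.card X = m}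

end MixedHypergraph

/-!
Let `a` and `b` be the greatest and the least element of `S`. A partition of `m` vertices into `a`
classes has at least `2 * a - m` singleton classes. If there are more than `b` of them, two lie in
a common class of a feasible partition into `b` classes, and merging them in the first partition
gives a feasible partition into `a - 1` classes; if there are more than `b + 1` of them, there are
two such merges. This bounds `m` from below.

For the construction, put vertices on two sides, at the levels `0, …, a - 1` and
`b, …, b + d - 1`, where `d` is `a - b` or, if `a - 1 ∈ S`, `a - 1 - b`. For `n ∈ S`, color a
vertex by its level if that is less than `n` and by its side otherwise, and take all the edges that
these colorings allow. A proper partition of the resulting hypergraph is determined by the least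
level `k` whose two vertices it separates: it is the partition for `n = k`. If it separates no
level, it is the partition for `n = a` or `n = b + d`.
-/

namespace MixedHypergraph

section Partitions

variable {X : Type*}

/-- A set of vertices is rainbow for a partition if it meets every class in at most one vertex. -/
def IsRainbow (r : Setoid X) (T : Set X) : Prop :=
  ∀ x ∈ T, ∀ y ∈ T, r x y → x = y

/-- A set of vertices is monochromatic for a partition if it lies in a single class. -/
def IsMonochromatic (r : Setoid X) (T : Set X) : Prop :=
  ∀ x ∈ T, ∀ y ∈ T, r x y

theorem IsRainbow.of_le {r p : Setoid X} (h : r ≤ p) {T : Set X} (hT : IsRainbow p T) :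
    IsRainbow r T :=
  fun x hx y hy hxy => hT x hx y hy (h hxy)

theorem IsRainbow.mono {r : Setoid X} {T U : Set X} (hTU : T ⊆ U) (hU : IsRainbow r U) :
    IsRainbow r T :=
  fun x hx y hy => hU x (hTU hx) y (hTU hy)

theorem IsRainbow.exists_transversal {r : Setoid X} {T : Set X} (hT : IsRainbow r T) :
    ∃ U, T ⊆ U ∧ IsRainbow r U ∧ ∀ x, ∃ u ∈ U, r u x := by
  have hinj : T.InjOn (Quotient.mk r) := fun x hx y hy hxy => hT x hx y hy (Quotient.exact hxy)
  obtain ⟨U, hTU, -, himage, hU⟩ := hinj.exists_subset_injOn_subset_range_eq (Set.subset_univ T)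
  refine ⟨U, hTU, fun x hx y hy hxy => hU hx hy (Quotient.sound hxy), fun x => ?_⟩
  obtain ⟨u, hu, hux⟩ : Quotient.mk r x ∈ Quotient.mk r '' U := himage ▸ ⟨x, trivial, rfl⟩
  exact ⟨u, hu, Quotient.exact hux⟩

theorem eq_of_le_of_isRainbow_transversal {r p : Setoid X} (hle : r ≤ p) {U : Set X}
    (hU : ∀ x, ∃ u ∈ U, r u x) (hp : IsRainbow p U) : r = p := by
  refine le_antisymm hle fun {x y} hxy => ?_
  obtain ⟨u, hu, hux⟩ := hU x
  obtain ⟨v, hv, hvy⟩ := hU y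
  obtain rfl := hp u hu v hv (p.trans' (hle hux) (p.trans' hxy (p.symm' (hle hvy))))
  exact r.trans' (r.symm' hux) hvy

/-- The vertices whose class in `r` is a singleton. -/
def singletonClasses (r : Setoid X) : Set X :=
  {x | ∀ y, r y x → y = x}

/-- Each class has either two vertices, or one vertex that is counted a second time on the
right. -/
theorem two_mul_card_quotient_le [Finite X] (r : Setoid X) :
    2 * Nat.card (Quotient r) ≤ Nat.card X + (singletonClasses r).ncard := by
  classical
  let f : X ⊕ singletonClasses r → Quotient r × Bool :=
    Sum.elim (fun x => (⟦x⟧, decide (x = (⟦x⟧ : Quotient r).out))) (fun x => (⟦x.1⟧, false))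
  have hf : Function.Surjective f := by
    rintro ⟨q, _ | _⟩
    · by_cases hq : q.out ∈ singletonClasses r
      · exact ⟨Sum.inr ⟨q.out, hq⟩, by simp [f]⟩
      · simp only [singletonClasses, Set.mem_ofPred_eq, not_forall] at hq
        obtain ⟨y, hy, hne⟩ := hq
        have hyq : ⟦y⟧ = q := (Quotient.sound hy).trans q.out_eq
        exact ⟨Sum.inl y, by simp [f, hyq, hne]⟩
    · exact ⟨Sum.inl q.out, by simp [f]⟩
  have := Nat.card_le_card_of_surjective f hf
  rw [Nat.card_prod, Nat.card_sum, Nat.card_coe_set_eq, Nat.card_eq_fintype_card (α := Bool),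
    Fintype.card_bool] at this
  omega

theorem exists_ne_rel_of_card_quotient_lt [Finite X] {r : Setoid X} {T : Set X}
    (h : Nat.card (Quotient r) < T.ncard) : ∃ x ∈ T, ∃ y ∈ T, x ≠ y ∧ r x y := by
  obtain ⟨x, hx, y, hy, hne, hxy⟩ := Set.exists_ne_map_eq_of_ncard_lt_of_maps_to
    (f := Quotient.mk r) (Set.ncard_univ _ ▸ h) fun _ _ => Set.mem_univ _
  exact ⟨x, hx, y, hy, hne, Quotient.exact hxy⟩

open Classical in
/-- The partition obtained from `r` by moving the vertex `x` to the class of `y`. If the class of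
`x` is a singleton, this merges the classes of `x` and `y`. -/
noncomputable def moveVertex (r : Setoid X) (x y : X) : Setoid X :=
  Setoid.ker (Function.update (Quotient.mk r) x ⟦y⟧)

theorem moveVertex_rel (r : Setoid X) {x y : X} (hne : x ≠ y) : moveVertex r x y x y := by
  classical
  rw [moveVertex, Setoid.ker_def, Function.update_self, Function.update_of_ne hne.symm]

theorem moveVertex_rel_iff {r : Setoid X} {x y u v : X} (hu : u ≠ x) (hv : v ≠ x) :
    moveVertex r x y u v ↔ r u v := by
  classical
  rw [moveVertex, Setoid.ker_def, Function.update_of_ne hu, Function.update_of_ne hv]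
  exact Quotient.eq

theorem moveVertex_rel_self_iff {r : Setoid X} {x y u : X} (hu : u ≠ x) :
    moveVertex r x y x u ↔ r y u := by
  classical
  rw [moveVertex, Setoid.ker_def, Function.update_self, Function.update_of_ne hu]
  exact Quotient.eq

theorem le_moveVertex {r : Setoid X} {x : X} (hx : x ∈ singletonClasses r) (y : X) :
    r ≤ moveVertex r x y := by
  intro u v huv
  rcases eq_or_ne u x with rfl | hu
  · rw [hx v (r.symm' huv)]
  rcases eq_or_ne v x with rfl | hv
  · rw [hx u huv]
  exact (moveVertex_rel_iff hu hv).2 huv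

theorem moveVertex_ne_moveVertex {r : Setoid X} {x y x' y' : X} (hx : x ∈ singletonClasses r)
    (hne : y ≠ x) (hxx' : x ≠ x') (hxy' : x ≠ y') : moveVertex r y x ≠ moveVertex r y' x' := by
  intro h
  have hyx : moveVertex r y' x' y x := h ▸ moveVertex_rel r hne
  rcases eq_or_ne y y' with rfl | hyy'
  · exact hxx' (hx x' ((moveVertex_rel_self_iff hxy').1 hyx)).symm
  · exact hne (hx y ((moveVertex_rel_iff hyy' hxy').1 hyx))

theorem card_quotient_moveVertex [Finite X] {r : Setoid X} {x y : X}
    (hx : x ∈ singletonClasses r) (hne : x ≠ y) :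
    Nat.card (Quotient (moveVertex r x y)) = Nat.card (Quotient r) - 1 := by
  classical
  have hrange : Set.range (Function.update (Quotient.mk r) x ⟦y⟧) = {⟦x⟧}ᶜ := by
    ext q
    simp only [Set.mem_range, Set.mem_compl_iff, Set.mem_singleton_iff]
    constructor
    · rintro ⟨u, rfl⟩
      rcases eq_or_ne u x with rfl | hu
      · rw [Function.update_self]
        exact fun h => hne (hx y (Quotient.exact h)).symm
      · rw [Function.update_of_ne hu]
        exact fun h => hu (hx u (Quotient.exact h))
    · induction q using Quotient.ind with | _ u =>
      intro hu
      exact ⟨u, Function.update_of_ne (ne_of_apply_ne _ hu) _ _⟩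
  rw [moveVertex, Nat.card_congr (Setoid.quotientKerEquivRange _), Nat.card_coe_set_eq, hrange,
    Set.ncard_compl, Set.ncard_singleton]

end Partitions

section ProperPartitions

variable {X : Type*} {H : MixedHypergraph X}

/-- The partition `r` is proper for `H` if its classes are the color classes of a proper
coloring of `H`, with any number of colors. -/
def IsProperPartition (H : MixedHypergraph X) (r : Setoid X) : Prop :=
  (∀ e ∈ H.cEdges, ¬ IsRainbow r e) ∧ ∀ e ∈ H.dEdges, ¬ IsMonochromatic r e

theorem isProperColoring_iff_isProperPartition_ker {k : ℕ} {c : X → Fin k} :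
    H.IsProperColoring c ↔ H.IsProperPartition (Setoid.ker c) := by
  simp only [IsProperColoring, IsProperPartition, IsRainbow, IsMonochromatic, Setoid.ker_def]
  push Not
  simp only [and_comm, ne_eq]

theorem mem_feasiblePartitions_iff [Finite X] {r : Setoid X} {k : ℕ} :
    r ∈ H.feasiblePartitions k ↔ H.IsProperPartition r ∧ Nat.card (Quotient r) = k := by
  constructor
  · rintro ⟨c, ⟨hc, hsurj⟩, rfl⟩
    refine ⟨isProperColoring_iff_isProperPartition_ker.1 hc, ?_⟩
    rw [Nat.card_congr (Setoid.quotientKerEquivOfSurjective c hsurj), Nat.card_fin]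
  · rintro ⟨hr, rfl⟩
    let g := Finite.equivFin (Quotient r)
    have hker : Setoid.ker (g ∘ Quotient.mk r) = r := by
      ext x y
      exact g.injective.eq_iff.trans Quotient.eq
    exact ⟨g ∘ Quotient.mk r, ⟨isProperColoring_iff_isProperPartition_ker.2 (hker.symm ▸ hr),
      g.surjective.comp Quotient.mk_surjective⟩, hker⟩

theorem mem_feasibleSet_iff {k : ℕ} :
    k ∈ H.feasibleSet ↔ (H.feasiblePartitions k).Nonempty :=
  ⟨fun ⟨c, hc⟩ => ⟨_, c, hc, rfl⟩, fun ⟨_, c, hc, _⟩ => ⟨c, hc⟩⟩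

theorem IsProperPartition.moveVertex {r p : Setoid X} (hr : H.IsProperPartition r)
    (hp : H.IsProperPartition p) {x y : X} (hx : x ∈ singletonClasses r)
    (hy : y ∈ singletonClasses r) (hxy : p x y) : H.IsProperPartition (moveVertex r x y) := by
  refine ⟨fun e he he' => hr.1 e he (he'.of_le (le_moveVertex hx y)), fun e he he' => ?_⟩
  have hxe : x ∈ e := by
    by_contra hxe
    exact hr.2 e he fun u hu v hv => (moveVertex_rel_iff (ne_of_mem_of_not_mem hu hxe)
      (ne_of_mem_of_not_mem hv hxe)).1 (he' u hu v hv)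
  have hsub : ∀ u ∈ e, u = x ∨ u = y := fun u hu => or_iff_not_imp_left.2 fun hux =>
    hy u (r.symm' ((moveVertex_rel_self_iff hux).1 (he' x hxe u hu)))
  refine hp.2 e he fun u hu v hv => ?_
  rcases hsub u hu with rfl | rfl <;> rcases hsub v hv with rfl | rfl
  exacts [p.refl' _, hxy, p.symm' hxy, p.refl' _]

theorem moveVertex_mem_feasiblePartitions [Finite X] {a : ℕ} {r p : Setoid X}
    (hr : r ∈ H.feasiblePartitions a) (hp : H.IsProperPartition p) {x y : X}
    (hx : x ∈ singletonClasses r) (hy : y ∈ singletonClasses r) (hne : x ≠ y) (hxy : p x y) :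
    moveVertex r x y ∈ H.feasiblePartitions (a - 1) := by
  rw [mem_feasiblePartitions_iff] at hr ⊢
  exact ⟨hr.1.moveVertex hp hx hy hxy, hr.2 ▸ card_quotient_moveVertex hx hne⟩

theorem pred_mem_feasibleSet [Finite X] {a b : ℕ} (ha : a ∈ H.feasibleSet)
    (hb : b ∈ H.feasibleSet) (h : Nat.card X + b < 2 * a) : a - 1 ∈ H.feasibleSet := by
  obtain ⟨r, hr⟩ := mem_feasibleSet_iff.1 ha
  obtain ⟨p, hp⟩ := mem_feasibleSet_iff.1 hb
  obtain ⟨-, hra⟩ := mem_feasiblePartitions_iff.1 hr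
  obtain ⟨hp, hpb⟩ := mem_feasiblePartitions_iff.1 hp
  have hcard := two_mul_card_quotient_le r
  obtain ⟨x, hx, y, hy, hne, hxy⟩ := exists_ne_rel_of_card_quotient_lt (r := p)
    (T := singletonClasses r) (by omega)
  exact mem_feasibleSet_iff.2 ⟨_, moveVertex_mem_feasiblePartitions hr hp hx hy hne hxy⟩

theorem one_lt_chromaticSpectrum_pred [Finite X] {a b : ℕ} (ha : a ∈ H.feasibleSet)
    (hb : b ∈ H.feasibleSet) (h : Nat.card X + b + 1 < 2 * a) :
    1 < H.chromaticSpectrum (a - 1) := by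
  obtain ⟨r, hr⟩ := mem_feasibleSet_iff.1 ha
  obtain ⟨p, hp⟩ := mem_feasibleSet_iff.1 hb
  obtain ⟨-, hra⟩ := mem_feasiblePartitions_iff.1 hr
  obtain ⟨hp, hpb⟩ := mem_feasiblePartitions_iff.1 hp
  have hcard := two_mul_card_quotient_le r
  obtain ⟨x, hx, y, hy, hne, hxy⟩ := exists_ne_rel_of_card_quotient_lt (r := p)
    (T := singletonClasses r) (by omega)
  have hdiff := Set.ncard_sdiff_singleton_add_one hx
  obtain ⟨x', ⟨hx', hx'x⟩, y', ⟨hy', hy'x⟩, hne', hxy'⟩ := exists_ne_rel_of_card_quotient_lt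
    (r := p) (T := singletonClasses r \ {x}) (by omega)
  have : Finite (Setoid X) := Finite.of_injective (fun r : Setoid X => ⇑r)
    fun _ _ => Setoid.eq_iff_rel_eq.2
  rw [chromaticSpectrum, Set.one_lt_ncard]
  exact ⟨_, moveVertex_mem_feasiblePartitions hr hp hy hx hne.symm (p.symm' hxy),
    _, moveVertex_mem_feasiblePartitions hr hp hy' hx' hne'.symm (p.symm' hxy'),
    moveVertex_ne_moveVertex hx hne.symm (Ne.symm hx'x) (Ne.symm hy'x)⟩

end ProperPartitions

section Spanned

variable {X : Type*}

theorem eq_of_isRainbow_of_isRainbow_superset {r p : Setoid X} {T : Set X} (hT : IsRainbow p T)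
    (hmeet : ∀ x, ∃ t ∈ T, p t x) (hclass : ∀ t ∈ T, ∀ x, r t x → p t x)
    (hsup : ∀ U, T ⊆ U → IsRainbow r U → IsRainbow p U) : r = p := by
  have hrT : IsRainbow r T := fun x hx y hy hxy => hT x hx y hy (hclass x hx y hxy)
  obtain ⟨U, hTU, hrU, hU⟩ := hrT.exists_transversal
  have hpU := hsup U hTU hrU
  have hUT : U ⊆ T := fun u hu => by
    obtain ⟨t, ht, htu⟩ := hmeet u
    exact hpU t (hTU ht) u hu htu ▸ ht
  refine eq_of_le_of_isRainbow_transversal (fun {x y} hxy => ?_) hU hpU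
  obtain ⟨u, hu, hux⟩ := hU x
  exact p.trans' (p.symm' (hclass u (hUT hu) x hux)) (hclass u (hUT hu) y (r.trans' hux hxy))

/-- The mixed hypergraph with all those edges that the partitions in `P` allow, i.e. the largest
one for which every member of `P` is proper. -/
def ofPartitions (P : Set (Setoid X)) : MixedHypergraph X where
  cEdges := {e | ∀ p ∈ P, ¬ IsRainbow p e}
  dEdges := {e | ∀ p ∈ P, ¬ IsMonochromatic p e}

theorem isProperPartition_ofPartitions {P : Set (Setoid X)} {p : Setoid X} (hp : p ∈ P) :
    (ofPartitions P).IsProperPartition p :=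
  ⟨fun _ he => he p hp, fun _ he => he p hp⟩

theorem IsProperPartition.exists_isRainbow {P : Set (Setoid X)} {r : Setoid X}
    (hr : (ofPartitions P).IsProperPartition r) {T : Set X} (hT : IsRainbow r T) :
    ∃ p ∈ P, IsRainbow p T := by
  by_contra! h
  exact hr.1 T h hT

theorem IsProperPartition.exists_isMonochromatic {P : Set (Setoid X)} {r : Setoid X}
    (hr : (ofPartitions P).IsProperPartition r) {T : Set X} (hT : IsMonochromatic r T) :
    ∃ p ∈ P, IsMonochromatic p T := by
  by_contra! h
  exact hr.2 T h hT

theorem isOneRealization_of_isProperPartition_iff [Finite X] {H : MixedHypergraph X} {S : Set ℕ}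
    {p : ℕ → Setoid X} (hcard : ∀ n ∈ S, Nat.card (Quotient (p n)) = n)
    (hH : ∀ r, H.IsProperPartition r ↔ ∃ n ∈ S, p n = r) : H.IsOneRealization S := by
  have hmem : ∀ {k r}, r ∈ H.feasiblePartitions k ↔ k ∈ S ∧ p k = r := by
    intro k r
    rw [mem_feasiblePartitions_iff, hH]
    constructor
    · rintro ⟨⟨n, hn, rfl⟩, rfl⟩
      rw [hcard n hn]
      exact ⟨hn, rfl⟩
    · rintro ⟨hk, rfl⟩
      exact ⟨⟨k, hk, rfl⟩, hcard k hk⟩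
  constructor
  · ext k
    rw [mem_feasibleSet_iff]
    exact ⟨fun ⟨_, hr⟩ => (hmem.1 hr).1, fun hk => ⟨p k, hmem.2 ⟨hk, rfl⟩⟩⟩
  · intro k
    rw [← Nat.le_one_iff_eq_zero_or_eq_one, chromaticSpectrum]
    calc (H.feasiblePartitions k).ncard ≤ ({p k} : Set (Setoid X)).ncard :=
          Set.ncard_le_ncard fun r hr => (hmem.1 hr).2.symm
      _ = 1 := Set.ncard_singleton _

end Spanned

/-- The vertices of the extremal one-realizations: two sides, with `a` and `d` vertices. -/
abbrev LevelVertex (a d : ℕ) : Type u := ULift.{u} (Fin a ⊕ Fin d)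

section Levels

variable {a b d : ℕ}

/-- The level of a vertex: side `0` has one vertex at each of the levels `0, …, a - 1`, and
side `1` has one vertex at each of the levels `b, …, b + d - 1`. -/
def level (b : ℕ) (x : LevelVertex.{u} a d) : ℕ :=
  x.down.elim (fun i => i.val) (fun j => b + j.val)

/-- The side, `0` or `1`, of a vertex. -/
def side (x : LevelVertex.{u} a d) : ℕ :=
  x.down.elim (fun _ => 0) (fun _ => 1)

theorem side_eq_zero_or_one (b : ℕ) (x : LevelVertex.{u} a d) :
    side x = 0 ∧ level b x < a ∨ side x = 1 ∧ b ≤ level b x ∧ level b x < b + d := by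
  rcases x with ⟨i | j⟩ <;> simp [level, side]

theorem eq_of_level_eq_of_side_eq {x y : LevelVertex.{u} a d} (hlevel : level b x = level b y)
    (hside : side x = side y) : x = y := by
  rcases x with ⟨i | i⟩ <;> rcases y with ⟨j | j⟩ <;> simp_all [level, side, Fin.ext_iff]

theorem exists_level_eq_side_zero (b d : ℕ) {i : ℕ} (hi : i < a) :
    ∃ x : LevelVertex.{u} a d, level b x = i ∧ side x = 0 :=
  ⟨⟨.inl ⟨i, hi⟩⟩, rfl, rfl⟩

theorem exists_level_eq_side_one (a : ℕ) {i : ℕ} (hbi : b ≤ i) (hi : i < b + d) :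
    ∃ x : LevelVertex.{u} a d, level b x = i ∧ side x = 1 :=
  ⟨⟨.inr ⟨i - b, by omega⟩⟩, by simp [level, hbi], rfl⟩

/-- The coloring by `n` colors in which a vertex is colored by its level if that is less than `n`,
and by its side otherwise. -/
def levelColoring (b n : ℕ) (x : LevelVertex.{u} a d) : ℕ :=
  if level b x < n then level b x else side x

/-- The partition of the vertices into the color classes of `levelColoring b n`. -/
def levelPartition (b n : ℕ) : Setoid (LevelVertex.{u} a d) :=
  Setoid.ker (levelColoring b n)

theorem levelPartition_rel_iff {n : ℕ} {x y : LevelVertex.{u} a d} :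
    levelPartition b n x y ↔ levelColoring b n x = levelColoring b n y :=
  Iff.rfl

theorem levelColoring_of_lt {n : ℕ} {x : LevelVertex.{u} a d} (h : level b x < n) :
    levelColoring b n x = level b x :=
  if_pos h

theorem levelColoring_of_le {n : ℕ} {x : LevelVertex.{u} a d} (h : n ≤ level b x) :
    levelColoring b n x = side x :=
  if_neg h.not_gt

theorem range_levelColoring {n : ℕ} (hn : 2 ≤ n) (hna : n ≤ a) :
    Set.range (levelColoring b n : LevelVertex.{u} a d → ℕ) = Set.Iio n := by
  ext i
  constructor
  · rintro ⟨x, rfl⟩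
    have := side_eq_zero_or_one b x
    simp only [levelColoring, Set.mem_Iio]
    split_ifs <;> omega
  · intro hi
    obtain ⟨x, rfl, -⟩ := exists_level_eq_side_zero b d (lt_of_lt_of_le hi hna)
    exact ⟨x, levelColoring_of_lt hi⟩

theorem card_quotient_levelPartition {n : ℕ} (hn : 2 ≤ n) (hna : n ≤ a) :
    Nat.card (Quotient (levelPartition b n : Setoid (LevelVertex.{u} a d))) = n := by
  rw [levelPartition, Nat.card_congr (Setoid.quotientKerEquivRange _),
    range_levelColoring hn hna, Nat.card_coe_set_eq, ← Finset.coe_Iio, Set.ncard_coe_finset,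
    Nat.card_Iio]

variable {S : Set ℕ} {r : Setoid (LevelVertex.{u} a d)} {k : ℕ}

theorem exists_levelColoring_eq_level (hbS : b ∈ lowerBounds S) (hda : b + d ≤ a)
    (hr : (ofPartitions (levelPartition b '' S)).IsProperPartition r) (hkd : k ≤ b + d)
    (hk : ∀ x y, level b x < k → level b x = level b y → r x y)
    {x : LevelVertex.{u} a d} (hx : level b x < k) :
    ∃ n, level b x < n ∧ ∀ y, r x y → levelColoring b n y = level b x := by
  obtain ⟨_, ⟨n, hn, rfl⟩, hmono⟩ := hr.exists_isMonochromatic (T := {y | r x y})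
    fun y hy z hz => r.trans' (r.symm' hy) hz
  have hbn : b ≤ n := hbS hn
  have hlt : level b x < n := by
    by_contra! hnx
    obtain ⟨u, hu, hu0⟩ := exists_level_eq_side_zero b d (show level b x < a by omega)
    obtain ⟨v, hv, hv1⟩ := exists_level_eq_side_one a (hbn.trans hnx) (hx.trans_le hkd)
    have huv := levelPartition_rel_iff.1 (hmono u (hk x u hx hu.symm) v (hk x v hx hv.symm))
    rw [levelColoring_of_le (hu ▸ hnx), levelColoring_of_le (hv ▸ hnx), hu0, hv1] at huv
    exact zero_ne_one huv
  exact ⟨n, hlt, fun y hy =>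
    (hmono y hy x (r.refl' x)).trans (levelColoring_of_lt hlt)⟩

theorem levelPartition_rel_of_level_lt (hbS : b ∈ lowerBounds S) (hda : b + d ≤ a)
    (hr : (ofPartitions (levelPartition b '' S)).IsProperPartition r) (hkd : k ≤ b + d)
    (hk : ∀ x y, level b x < k → level b x = level b y → r x y)
    {x y : LevelVertex.{u} a d} (hx : level b x < k) (hxy : r x y) :
    levelPartition b k x y := by
  obtain ⟨n, hn, hclass⟩ := exists_levelColoring_eq_level hbS hda hr hkd hk hx
  have hyx := hclass y hxy
  rw [levelPartition_rel_iff, levelColoring_of_lt hx]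
  rcases lt_or_ge (level b y) k with hy | hy
  · obtain ⟨m, hm, hclass'⟩ := exists_levelColoring_eq_level hbS hda hr hkd hk hy
    have hxy' := hclass' x (r.symm' hxy)
    rw [levelColoring_of_lt hy]
    simp only [levelColoring] at hyx hxy'
    split_ifs at hyx hxy' <;> omega
  · rw [levelColoring_of_le hy]
    simp only [levelColoring] at hyx
    split_ifs at hyx <;> omega

/-- A transversal of `levelPartition b k` containing the vertices of level `k`. -/
def levelTransversal (b k : ℕ) : Set (LevelVertex.{u} a d) :=
  {x | level b x = k ∨ 2 ≤ level b x ∧ level b x < k ∧ side x = 0}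

theorem isRainbow_levelTransversal :
    IsRainbow (levelPartition b k) (levelTransversal b k : Set (LevelVertex.{u} a d)) := by
  intro x hx y hy hxy
  have hsx := side_eq_zero_or_one b x
  have hsy := side_eq_zero_or_one b y
  simp only [levelTransversal, Set.mem_ofPred_eq] at hx hy
  rw [levelPartition_rel_iff] at hxy
  simp only [levelColoring] at hxy
  split_ifs at hxy <;> exact eq_of_level_eq_of_side_eq (b := b) (by omega) (by omega)

theorem exists_levelTransversal_rel (hda : b + d ≤ a) (hbk : b ≤ k) (hkd : k < b + d)
    (x : LevelVertex.{u} a d) : ∃ t ∈ levelTransversal b k, levelPartition b k t x := by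
  by_cases hx : 2 ≤ level b x ∧ level b x < k
  · obtain ⟨t, ht, ht0⟩ := exists_level_eq_side_zero b d (show level b x < a by omega)
    refine ⟨t, Or.inr ⟨by omega, by omega, ht0⟩, ?_⟩
    rw [levelPartition_rel_iff, levelColoring_of_lt (by omega), levelColoring_of_lt hx.2, ht]
  · have hcolor : levelColoring b k x = 0 ∨ levelColoring b k x = 1 := by
      have := side_eq_zero_or_one b x
      simp only [levelColoring]
      split_ifs <;> omega
    obtain ⟨t, ht, hside⟩ :
        ∃ t : LevelVertex.{u} a d, level b t = k ∧ side t = levelColoring b k x := by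
      rcases hcolor with h | h <;> rw [h]
      · exact exists_level_eq_side_zero b d (by omega)
      · exact exists_level_eq_side_one a hbk hkd
    exact ⟨t, Or.inl ht, levelPartition_rel_iff.2 ((levelColoring_of_le ht.ge).trans hside)⟩

theorem eq_of_isRainbow_levelPartition (hb : 2 ≤ b) (hda : b + d ≤ a) (hbk : b ≤ k)
    (hkd : k < b + d) {n : ℕ} (hbn : b ≤ n)
    (h : IsRainbow (levelPartition b n) (levelTransversal b k : Set (LevelVertex.{u} a d))) :
    n = k := by
  obtain ⟨u, hu, hu0⟩ := exists_level_eq_side_zero b d (show k < a by omega)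
  obtain ⟨v, hv, hv1⟩ := exists_level_eq_side_one a hbk hkd
  rcases lt_trichotomy n k with hnk | rfl | hkn
  · obtain ⟨w, hw, hw0⟩ := exists_level_eq_side_zero b d (show n < a by omega)
    have hwu : w = u := h w (Or.inr (by omega)) u (Or.inl hu) (by
      rw [levelPartition_rel_iff, levelColoring_of_le hw.ge, levelColoring_of_le (hu ▸ hnk.le),
        hw0, hu0])
    subst hwu
    omega
  · rfl
  · have huv : u = v := h u (Or.inl hu) v (Or.inl hv) (by
      rw [levelPartition_rel_iff, levelColoring_of_lt (hu ▸ hkn), levelColoring_of_lt (hv ▸ hkn),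
        hu, hv])
    subst huv
    omega

theorem side_eq_of_rel_of_level_eq {u v x y : LevelVertex.{u} a d} (huv : ¬ r u v)
    (hlevel : level b u = level b v) (hx : level b x = level b u) (hy : level b y = level b u)
    (hxy : r x y) : side x = side y := by
  by_contra hne
  have hsu : side u ≠ side v := fun h => huv (eq_of_level_eq_of_side_eq hlevel h ▸ r.refl' u)
  have hside := fun z : LevelVertex.{u} a d => side_eq_zero_or_one b z
  by_cases hux : side u = side x
  · obtain rfl : u = x := eq_of_level_eq_of_side_eq hx.symm hux
    obtain rfl : v = y := eq_of_level_eq_of_side_eq (b := b) (by omega)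
      (by grind)
    exact huv hxy
  · obtain rfl : u = y := eq_of_level_eq_of_side_eq hy.symm (by grind)
    obtain rfl : v = x := eq_of_level_eq_of_side_eq (b := b) (by omega)
      (by grind)
    exact huv (r.symm' hxy)

theorem levelPartition_rel_of_mem_levelTransversal (hb : 2 ≤ b) (hbS : b ∈ lowerBounds S)
    (hda : b + d ≤ a) (hr : (ofPartitions (levelPartition b '' S)).IsProperPartition r)
    (hbk : b ≤ k) (hkd : k ≤ b + d)
    (hk : ∀ x y, level b x < k → level b x = level b y → r x y)
    (hsplit : ∀ x y, level b x = k → level b y = k → r x y → side x = side y)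
    {t x : LevelVertex.{u} a d} (ht : t ∈ levelTransversal b k) (htx : r t x) :
    levelPartition b k t x := by
  rcases ht with ht | ⟨-, ht, -⟩
  · rcases lt_or_ge (level b x) k with hx | hx
    · exact (levelPartition b k).symm'
        (levelPartition_rel_of_level_lt hbS hda hr hkd hk hx (r.symm' htx))
    · rw [levelPartition_rel_iff, levelColoring_of_le ht.ge, levelColoring_of_le hx]
      obtain ⟨_, ⟨n, -, rfl⟩, hmono⟩ := hr.exists_isMonochromatic (T := {y | r t y})
        fun y hy z hz => r.trans' (r.symm' hy) hz
      have hcolor := levelPartition_rel_iff.1 (hmono t (r.refl' t) x htx)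
      have hsx := side_eq_zero_or_one b x
      rcases le_or_gt n k with hnk | hkn
      · rwa [levelColoring_of_le (ht.symm ▸ hnk), levelColoring_of_le (hnk.trans hx)] at hcolor
      · have hxk : level b x = k := by
          rw [levelColoring_of_lt (ht.symm ▸ hkn), levelColoring] at hcolor
          split_ifs at hcolor <;> omega
        exact hsplit t x ht hxk htx
  · exact levelPartition_rel_of_level_lt hbS hda hr hkd hk ht htx

theorem levelPartition_eq_of_split (hb : 2 ≤ b) (hbS : b ∈ lowerBounds S) (hda : b + d ≤ a)
    (hr : (ofPartitions (levelPartition b '' S)).IsProperPartition r)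
    (hk : ∀ x y, level b x < k → level b x = level b y → r x y)
    {u v : LevelVertex.{u} a d} (hu : level b u = k) (hv : level b v = k) (huv : ¬ r u v) :
    k ∈ S ∧ levelPartition b k = r := by
  have hsu : side u ≠ side v := fun h =>
    huv (eq_of_level_eq_of_side_eq (hu.trans hv.symm) h ▸ r.refl' u)
  obtain ⟨hbk, hkd⟩ : b ≤ k ∧ k < b + d := by
    have := side_eq_zero_or_one b u
    have := side_eq_zero_or_one b v
    omega
  have hrainbow := isRainbow_levelTransversal (b := b) (a := a) (d := d) (k := k)
  have hsup : ∀ U, levelTransversal b k ⊆ U → IsRainbow r U →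
      k ∈ S ∧ IsRainbow (levelPartition b k) U := by
    intro U hTU hU
    obtain ⟨_, ⟨n, hn, rfl⟩, hnU⟩ := hr.exists_isRainbow hU
    obtain rfl := eq_of_isRainbow_levelPartition hb hda hbk hkd (hbS hn) (hnU.mono hTU)
    exact ⟨hn, hnU⟩
  have heq : r = levelPartition b k := eq_of_isRainbow_of_isRainbow_superset hrainbow
    (exists_levelTransversal_rel hda hbk hkd)
    (fun t ht x htx => levelPartition_rel_of_mem_levelTransversal hb hbS hda hr hbk hkd.le hk
      (fun x y hx hy => side_eq_of_rel_of_level_eq huv (hu.trans hv.symm) (hx.trans hu.symm)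
        (hy.trans hu.symm)) ht htx)
    fun U hTU hU => (hsup U hTU hU).2
  exact ⟨(hsup _ subset_rfl (heq ▸ hrainbow)).1, heq.symm⟩

theorem le_levelPartition_of_level_eq_imp_rel (hbS : b ∈ lowerBounds S) (hda : b + d ≤ a)
    (hr : (ofPartitions (levelPartition b '' S)).IsProperPartition r)
    (hlevel : ∀ x y, level b x = level b y → r x y) : r ≤ levelPartition b (b + d) := by
  intro x y hxy
  have hlow : ∀ {u v}, level b u < b + d → r u v → levelPartition b (b + d) u v :=
    levelPartition_rel_of_level_lt hbS hda hr le_rfl fun x y _ => hlevel x y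
  rcases lt_or_ge (level b x) (b + d) with hx | hx
  · exact hlow hx hxy
  rcases lt_or_ge (level b y) (b + d) with hy | hy
  · exact (levelPartition b (b + d)).symm' (hlow hy (r.symm' hxy))
  rw [levelPartition_rel_iff, levelColoring_of_le hx, levelColoring_of_le hy]
  have := side_eq_zero_or_one b x
  have := side_eq_zero_or_one b y
  omega

theorem levelColoring_eq_zero_of_le {x : LevelVertex.{u} a d} (hx : b + d ≤ level b x) :
    levelColoring b (b + d) x = 0 := by
  have := side_eq_zero_or_one b x
  rw [levelColoring_of_le hx]
  omega

theorem levelPartition_le_of_level_eq_imp_rel (hlevel : ∀ x y, level b x = level b y → r x y)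
    (htop : ∀ x y, b + d ≤ level b x → level b y = 0 → r x y) :
    levelPartition b (b + d) ≤ r := by
  intro x y hxy
  rw [levelPartition_rel_iff] at hxy
  rcases lt_or_ge (level b x) (b + d) with hx | hx <;>
    rcases lt_or_ge (level b y) (b + d) with hy | hy
  · rw [levelColoring_of_lt hx, levelColoring_of_lt hy] at hxy
    exact hlevel x y hxy
  · rw [levelColoring_of_lt hx, levelColoring_eq_zero_of_le hy] at hxy
    exact r.symm' (htop y x hy hxy)
  · rw [levelColoring_eq_zero_of_le hx, levelColoring_of_lt hy] at hxy
    exact htop x y hx hxy.symm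
  · obtain ⟨o, ho, -⟩ := exists_level_eq_side_zero.{u} (a := a) b d (i := 0) (by
      have := side_eq_zero_or_one b x
      omega)
    exact r.trans' (htop x o hx ho) (r.symm' (htop y o hy ho))

theorem levelPartition_eq_of_not_rel (hbS : b ∈ lowerBounds S) (hd : b + d + 1 = a)
    (hr : (ofPartitions (levelPartition b '' S)).IsProperPartition r)
    (hlevel : ∀ x y, level b x = level b y → r x y) {z o : LevelVertex.{u} a d}
    (hz : level b z = b + d) (ho : level b o = 0) (hzo : ¬ r z o) : levelPartition b a = r := by
  have hlt : ∀ x : LevelVertex.{u} a d, level b x < a := fun x => by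
    have := side_eq_zero_or_one b x
    omega
  have hrel : ∀ x y, levelPartition b a x y ↔ level b x = level b y := fun x y => by
    rw [levelPartition_rel_iff, levelColoring_of_lt (hlt x), levelColoring_of_lt (hlt y)]
  have htop : ∀ x y, b + d ≤ level b x → level b y < b + d → ¬ r x y := fun x y hx hy hxy => by
    have hcolor := levelPartition_rel_iff.1
      (le_levelPartition_of_level_eq_imp_rel hbS (by omega) hr hlevel hxy)
    rw [levelColoring_eq_zero_of_le hx, levelColoring_of_lt hy] at hcolor
    have hzx : level b z = level b x := by
      have := hlt x
      omega
    exact hzo (r.trans' (hlevel z x hzx) (r.trans' hxy (hlevel y o (hcolor.symm.trans ho.symm))))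
  refine le_antisymm (fun {x y} hxy => hlevel x y ((hrel x y).1 hxy)) fun {x y} hxy =>
    (hrel x y).2 ?_
  rcases lt_or_ge (level b x) (b + d) with hx | hx <;>
    rcases lt_or_ge (level b y) (b + d) with hy | hy
  · have hcolor := levelPartition_rel_iff.1
      (le_levelPartition_of_level_eq_imp_rel hbS (by omega) hr hlevel hxy)
    rwa [levelColoring_of_lt hx, levelColoring_of_lt hy] at hcolor
  · exact (htop y x hy hx (r.symm' hxy)).elim
  · exact (htop x y hx hy hxy).elim
  · have := hlt x
    have := hlt y
    omega

theorem exists_levelPartition_eq_of_level_eq_imp_rel (hbS : b ∈ lowerBounds S) (haS : a ∈ S)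
    (hd : b + d = a ∨ b + d + 1 = a ∧ b + d ∈ S)
    (hr : (ofPartitions (levelPartition b '' S)).IsProperPartition r)
    (hlevel : ∀ x y : LevelVertex.{u} a d, level b x = level b y → r x y) :
    ∃ n ∈ S, levelPartition b n = r := by
  have hle := le_levelPartition_of_level_eq_imp_rel hbS (by omega) hr hlevel
  rcases hd with hd | ⟨hd, hdS⟩
  · refine ⟨b + d, hd ▸ haS, le_antisymm ?_ hle⟩
    refine levelPartition_le_of_level_eq_imp_rel hlevel fun x _ hx => ?_
    have := side_eq_zero_or_one b x
    omega
  · by_cases hzo : ∃ z o : LevelVertex.{u} a d, level b z = b + d ∧ level b o = 0 ∧ ¬ r z o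
    · obtain ⟨z, o, hz, ho, hzo⟩ := hzo
      exact ⟨a, haS, levelPartition_eq_of_not_rel hbS hd hr hlevel hz ho hzo⟩
    · push Not at hzo
      refine ⟨b + d, hdS, le_antisymm ?_ hle⟩
      refine levelPartition_le_of_level_eq_imp_rel hlevel fun x y hx hy => hzo x y ?_ hy
      have := side_eq_zero_or_one b x
      omega

theorem isProperPartition_ofPartitions_levelPartition_iff (hb : 2 ≤ b) (hbS : b ∈ lowerBounds S)
    (haS : a ∈ S) (hd : b + d = a ∨ b + d + 1 = a ∧ b + d ∈ S) :
    (ofPartitions (levelPartition b '' S)).IsProperPartition r ↔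
      ∃ n ∈ S, levelPartition b n = r := by
  classical
  refine ⟨fun hr => ?_, fun hr => isProperPartition_ofPartitions hr⟩
  by_cases hsplit : ∃ k, ∃ u v : LevelVertex.{u} a d, level b u = k ∧ level b v = k ∧ ¬ r u v
  · obtain ⟨u, v, hu, hv, huv⟩ := Nat.find_spec hsplit
    refine ⟨_, levelPartition_eq_of_split hb hbS (by omega) hr (fun x y hx hxy => ?_) hu hv huv⟩
    by_contra hne
    exact Nat.find_min hsplit hx ⟨x, y, rfl, hxy.symm, hne⟩
  · push Not at hsplit
    exact exists_levelPartition_eq_of_level_eq_imp_rel hbS haS hd hr fun x y hxy =>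
      hsplit _ x y rfl hxy.symm

theorem add_mem_oneRealizationSizes (hb : 2 ≤ b) (hbS : b ∈ lowerBounds S)
    (ha : IsGreatest S a) (hd : b + d = a ∨ b + d + 1 = a ∧ b + d ∈ S) :
    a + d ∈ oneRealizationSizes.{u} S :=
  ⟨LevelVertex.{u} a d, inferInstance, ofPartitions (levelPartition b '' S),
    isOneRealization_of_isProperPartition_iff
      (fun _ hn => card_quotient_levelPartition (hb.trans (hbS hn)) (ha.2 hn))
      fun _ => isProperPartition_ofPartitions_levelPartition_iff hb hbS ha.1 hd,
    by simp⟩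

end Levels

section Sizes

variable {S : Set ℕ} {a b : ℕ}

theorem isLeast_oneRealizationSizes_of_pred_notMem (ha : IsGreatest S a) (hb : IsLeast S b)
    (h2b : 2 ≤ b) (hpred : a - 1 ∉ S) : IsLeast (oneRealizationSizes.{u} S) (2 * a - b) := by
  have hba : b ≤ a := hb.2 ha.1
  constructor
  · rw [show 2 * a - b = a + (a - b) by omega]
    exact add_mem_oneRealizationSizes h2b hb.2 ha (Or.inl (by omega))
  · rintro _ ⟨X, _, H, ⟨rfl, -⟩, rfl⟩
    by_contra! hlt
    exact hpred (pred_mem_feasibleSet ha.1 hb.1 (by omega))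

theorem isLeast_oneRealizationSizes_of_pred_mem (ha : IsGreatest S a) (hb : IsLeast S b)
    (h2b : 2 ≤ b) (hpred : a - 1 ∈ S) :
    IsLeast (oneRealizationSizes.{u} S) (2 * a - b - 1) := by
  have hba : b ≤ a - 1 := hb.2 hpred
  constructor
  · rw [show 2 * a - b - 1 = a + (a - 1 - b) by omega]
    refine add_mem_oneRealizationSizes h2b hb.2 ha (Or.inr ⟨by omega, ?_⟩)
    rwa [Nat.add_sub_cancel' hba]
  · rintro _ ⟨X, _, H, ⟨rfl, hspectrum⟩, rfl⟩
    by_contra! hlt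
    have := one_lt_chromaticSpectrum_pred ha.1 hb.1 (by omega)
    have := hspectrum (a - 1)
    omega

end Sizes

end MixedHypergraph

theorem theorem1p1 (s : ℕ) (hs : 2 ≤ s) (n : ℕ → ℕ)
    (hn : StrictAntiOn n (Set.Icc 1 s)) (hns : 2 ≤ n s) :
    (n 1 > n 2 + 1 →
      IsLeast (MixedHypergraph.oneRealizationSizes.{u} (n '' Set.Icc 1 s))
        (2 * n 1 - n s)) ∧
    (n 1 = n 2 + 1 →
      IsLeast (MixedHypergraph.oneRealizationSizes.{u} (n '' Set.Icc 1 s))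
        (2 * n 1 - n s - 1)) := by
  have h1s : 1 ≤ s := one_le_two.trans hs
  have hgreatest : IsGreatest (n '' Set.Icc 1 s) (n 1) :=
    hn.antitoneOn.map_isLeast (isLeast_Icc h1s)
  have hleast : IsLeast (n '' Set.Icc 1 s) (n s) :=
    hn.antitoneOn.map_isGreatest (isGreatest_Icc h1s)
  refine ⟨fun h => ?_, fun h => ?_⟩
  · refine MixedHypergraph.isLeast_oneRealizationSizes_of_pred_notMem hgreatest hleast hns ?_
    rintro ⟨i, hi, hni⟩
    rcases hi.1.eq_or_lt with rfl | h2i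
    · omega
    · have := hn.antitoneOn ⟨one_le_two, hs⟩ hi h2i
      omega
  · refine MixedHypergraph.isLeast_oneRealizationSizes_of_pred_mem hgreatest hleast hns ?_
    exact ⟨2, ⟨one_le_two, hs⟩, by omega⟩
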